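/- Let $\mathcal H\neq\{0\}$ and $\mathcal K$ be complex Hilbert spaces, let $\mathcal H\otimes\mathcal K$ be their Hilbert space tensor product, and let $U$ be a unitary operator on $\mathcal H\otimes\mathcal K$. For $f,g\in\mathcal H$ and a bounded operator $Y$ on $\mathcal H\otimes\mathcal K$, let $Y(f,g)=\mathrm{Tr}_{|g\rangle\langle f|}[Y]$ be the bounded operator on $\mathcal K$ determined by $\langle\varphi,Y(f,g)\psi\rangle=\langle f\otimes\varphi,Y(g\otimes\psi)\rangle$ for all $\varphi,\psi\in\mathcal K$. Write $U^*(f,g)$ for $Y(f,g)$ with $Y=U^*$. The Environment Right-Action Algebra of $U$ is the von Neumann algebra on $\mathcal K$ given by the bicommutant $$\mathcal A_r(U)=\{U^*(f_1,g_1)\,U(f_2,g_2)\;:\; f_1,g_1,f_2,g_2\in\mathcal H\}''.$$ For a unit vector $\psi\in\mathcal K$, let $U_\psi:\mathcal H\to\mathcal H\otimes\mathcal K$ be the map $f\mapsto U(f\otimes\psi)$, and let $\mathcal L_{|\psi\rangle\langle\psi|}(X)=\mathrm{Tr}_{|\psi\rangle\langle\psi|}[U^*(X\otimes I)U]$ for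 $X\in\mathcal B(\mathcal H)$, where $\langle f,\mathrm{Tr}_{|\psi\rangle\langle\psi|}[Y]g\rangle=\langle f\otimes\psi,Y(g\otimes\psi)\rangle$ for all $f,g\in\mathcal H$. A Stinespring representation $(\mathcal H\otimes\mathcal K,V)$ of a normal completely positive map $\mathcal L$ on $\mathcal B(\mathcal H)$ consists of an isometry $V:\mathcal H\to\mathcal H\otimes\mathcal K$ with $\mathcal L(X)=V^*(X\otimes I)V$ for all $X\in\mathcal B(\mathcal H)$; it is minimal if the linear span of $\{(X\otimes I)Vf: X\in\mathcal B(\mathcal H),\ f\in\mathcal H\}$ is dense in $\mathcal H\otimes\mathcal K$. If for every unit vector $\psi\in\mathcal K$ the pair $(\mathcal H\otimes\mathcal K,U_\psi)$ is a minimal Stinespring representation of $\mathcal L_{|\psi\rangle\langle\psi|}$, then $\mathcal A_r(U)=\mathcal B(\mathcal K)$. -/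

import Mathlib

open scoped TensorProduct InnerProductSpace

noncomputable section

namespace EnvAction

/-- The Hilbert space tensor product `H ⊗ K`: the completion of the algebraic tensor product for
the inner product determined by `⟪f ⊗ φ, g ⊗ ψ⟫ = ⟪f, g⟫ ⟪φ, ψ⟫`. -/
abbrev HilbertTensor (H K : Type*) [NormedAddCommGroup H] [InnerProductSpace ℂ H]
    [NormedAddCommGroup K] [InnerProductSpace ℂ K] : Type _ :=
  UniformSpace.Completion (H ⊗[ℂ] K)

section

variable {H K : Type*} [NormedAddCommGroup H] [InnerProductSpace ℂ H]
  [NormedAddCommGroup K] [InnerProductSpace ℂ K]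

/-- The elementary tensor `f ⊗ ψ` in the Hilbert space tensor product. -/
def pureTensor (f : H) (ψ : K) : HilbertTensor H K :=
  ((f ⊗ₜ[ℂ] ψ : H ⊗[ℂ] K) : UniformSpace.Completion (H ⊗[ℂ] K))

/-- The bounded operator `K → H ⊗ K`, `φ ↦ f ⊗ φ`. -/
def tensorLeft (f : H) : K →L[ℂ] HilbertTensor H K :=
  (UniformSpace.Completion.toComplL : (H ⊗[ℂ] K) →L[ℂ] HilbertTensor H K) ∘L
    TensorProduct.mkL ℂ H K f

/-- The bounded operator `H → H ⊗ K`, `f ↦ f ⊗ ψ`. -/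
def tensorRight (ψ : K) : H →L[ℂ] HilbertTensor H K :=
  (UniformSpace.Completion.toComplL : (H ⊗[ℂ] K) →L[ℂ] HilbertTensor H K) ∘L
    (TensorProduct.mkL ℂ H K).flip ψ

theorem tensorLeft_apply (f : H) (φ : K) : tensorLeft f φ = pureTensor f φ := rfl

theorem tensorRight_apply (ψ : K) (f : H) : tensorRight ψ f = pureTensor f ψ := rfl

theorem inner_pureTensor (f g : H) (φ ψ : K) :
    ⟪pureTensor f φ, pureTensor g ψ⟫_ℂ = ⟪f, g⟫_ℂ * ⟪φ, ψ⟫_ℂ := by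
  simp [pureTensor]

/-- The bounded operator `X ⊗ I` on `H ⊗ K`, for `X` a bounded operator on `H`. -/
def ampliation (K : Type*) [NormedAddCommGroup K] [InnerProductSpace ℂ K] (X : H →L[ℂ] H) :
    HilbertTensor H K →L[ℂ] HilbertTensor H K :=
  (X.rTensor K).completion

theorem ampliation_pureTensor (X : H →L[ℂ] H) (f : H) (ψ : K) :
    ampliation K X (pureTensor f ψ) = pureTensor (X f) ψ := by
  simp [ampliation, pureTensor]

section

variable [CompleteSpace H]

/-- The partial trace `Tr_{|ψ⟩⟨φ|}[Y]` over `K`, a bounded operator on `H`. It is the operator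
with `⟪f, Tr_{|ψ⟩⟨φ|}[Y] g⟫ = Tr[(|g⟩⟨f| ⊗ |ψ⟩⟨φ|) Y] = ⟪f ⊗ φ, Y (g ⊗ ψ)⟫`. -/
def sysPartialTrace (ψ φ : K) (Y : HilbertTensor H K →L[ℂ] HilbertTensor H K) : H →L[ℂ] H :=
  ContinuousLinearMap.adjoint (tensorRight φ) ∘L Y ∘L tensorRight ψ

theorem inner_sysPartialTrace (ψ φ : K) (Y : HilbertTensor H K →L[ℂ] HilbertTensor H K)
    (f g : H) :
    ⟪f, sysPartialTrace ψ φ Y g⟫_ℂ = ⟪pureTensor f φ, Y (pureTensor g ψ)⟫_ℂ := by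
  simp [sysPartialTrace, ContinuousLinearMap.adjoint_inner_right, tensorRight_apply]

end

variable [CompleteSpace K]

/-- The partial trace `Y(f, g) = Tr_{|g⟩⟨f|}[Y]` over `H`, a bounded operator on `K`. It is the
operator with `⟪φ, Y(f, g) ψ⟫ = Tr[(|g⟩⟨f| ⊗ |ψ⟩⟨φ|) Y] = ⟪f ⊗ φ, Y (g ⊗ ψ)⟫`. -/
def envPartialTrace (Y : HilbertTensor H K →L[ℂ] HilbertTensor H K) (f g : H) : K →L[ℂ] K :=
  ContinuousLinearMap.adjoint (tensorLeft f) ∘L Y ∘L tensorLeft g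

theorem inner_envPartialTrace (Y : HilbertTensor H K →L[ℂ] HilbertTensor H K) (f g : H)
    (φ ψ : K) :
    ⟪φ, envPartialTrace Y f g ψ⟫_ℂ = ⟪pureTensor f φ, Y (pureTensor g ψ)⟫_ℂ := by
  simp [envPartialTrace, ContinuousLinearMap.adjoint_inner_right, tensorLeft_apply]

/-- The products `U*(f₁, g₁) U(f₂, g₂)`, with `f₁, g₁, f₂, g₂` in `H`. -/
def rightActionGenerators (U : HilbertTensor H K →L[ℂ] HilbertTensor H K) : Set (K →L[ℂ] K) :=
  {A | ∃ f₁ g₁ f₂ g₂ : H,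
    A = envPartialTrace (ContinuousLinearMap.adjoint U) f₁ g₁ ∘L envPartialTrace U f₂ g₂}

theorem star_envPartialTrace (Y : HilbertTensor H K →L[ℂ] HilbertTensor H K) (f g : H) :
    star (envPartialTrace Y f g) = envPartialTrace (ContinuousLinearMap.adjoint Y) g f := by
  simp only [envPartialTrace, ContinuousLinearMap.star_eq_adjoint,
    ContinuousLinearMap.adjoint_comp, ContinuousLinearMap.adjoint_adjoint]
  rfl

theorem star_rightActionGenerators (U : HilbertTensor H K →L[ℂ] HilbertTensor H K) :
    star (rightActionGenerators U) = rightActionGenerators U := by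
  have key : ∀ A ∈ rightActionGenerators U, star A ∈ rightActionGenerators U := by
    rintro _ ⟨f₁, g₁, f₂, g₂, rfl⟩
    exact ⟨g₂, f₂, g₁, f₁, by
      rw [← ContinuousLinearMap.mul_def, star_mul, ContinuousLinearMap.mul_def,
        star_envPartialTrace, star_envPartialTrace,
        ContinuousLinearMap.adjoint_adjoint]⟩
  ext A
  exact ⟨fun h => by simpa using key _ h, fun h => key _ h⟩

theorem star_mem_centralizer_of_star_eq {S : Set (K →L[ℂ] K)} (hS : star S = S)
    {A : K →L[ℂ] K} (hA : A ∈ Set.centralizer S) : star A ∈ Set.centralizer S := by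
  intro B hB
  have hB' : star B ∈ S := by
    rw [← hS]
    simpa using hB
  simpa using (congrArg star (hA (star B) hB')).symm

theorem star_centralizer_of_star_eq {S : Set (K →L[ℂ] K)} (hS : star S = S) :
    star (Set.centralizer S) = Set.centralizer S := by
  ext A
  exact ⟨fun h => by simpa using star_mem_centralizer_of_star_eq hS h,
    fun h => star_mem_centralizer_of_star_eq hS h⟩

/-- The Environment Right-Action Algebra of `U`: the von Neumann algebra on `K` whose underlying
set is the bicommutant of the operators `U*(f₁, g₁) U(f₂, g₂)`. -/
def rightActionAlgebra (U : HilbertTensor H K →L[ℂ] HilbertTensor H K) : VonNeumannAlgebra K where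
  toStarSubalgebra :=
    { Subalgebra.centralizer ℂ (Set.centralizer (rightActionGenerators U)) with
      star_mem' := fun hA => star_mem_centralizer_of_star_eq
        (star_centralizer_of_star_eq (star_rightActionGenerators U)) hA }
  centralizer_centralizer' :=
    Set.centralizer_centralizer_centralizer (Set.centralizer (rightActionGenerators U))

theorem coe_rightActionAlgebra (U : HilbertTensor H K →L[ℂ] HilbertTensor H K) :
    (rightActionAlgebra U : Set (K →L[ℂ] K)) =
      Set.centralizer (Set.centralizer (rightActionGenerators U)) := rfl

/-- The operator `U_ψ : H → H ⊗ K`, `f ↦ U (f ⊗ ψ)`. -/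
def dilation (U : HilbertTensor H K →L[ℂ] HilbertTensor H K) (ψ : K) :
    H →L[ℂ] HilbertTensor H K :=
  U ∘L tensorRight ψ

variable [CompleteSpace H]

/-- The map `L_{|ψ⟩⟨ψ|} : X ↦ Tr_{|ψ⟩⟨ψ|}[U* (X ⊗ I) U]` on the bounded operators on `H`. -/
def reducedMap (U : HilbertTensor H K →L[ℂ] HilbertTensor H K) (ψ : K) (X : H →L[ℂ] H) :
    H →L[ℂ] H :=
  sysPartialTrace ψ ψ (ContinuousLinearMap.adjoint U ∘L ampliation K X ∘L U)

/-- `(H ⊗ K, V)` is a Stinespring representation of `L`: `V` is an isometry from `H` to `H ⊗ K`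
and `L X = V* (X ⊗ I) V` for every `X`. Every map `L` of this form is normal and completely
positive, so these properties of `L` are not repeated. -/
def IsStinespring (L : (H →L[ℂ] H) → (H →L[ℂ] H)) (V : H →L[ℂ] HilbertTensor H K) : Prop :=
  Isometry V ∧
    ∀ X : H →L[ℂ] H, L X = ContinuousLinearMap.adjoint V ∘L ampliation K X ∘L V

/-- A Stinespring representation `(H ⊗ K, V)` is minimal if the set of the vectors `(X ⊗ I) V f`
is total in `H ⊗ K`. -/
def IsMinimalStinespring (L : (H →L[ℂ] H) → (H →L[ℂ] H)) (V : H →L[ℂ] HilbertTensor H K) :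
    Prop :=
  IsStinespring L V ∧
    (Submodule.span ℂ {x : HilbertTensor H K |
      ∃ (X : H →L[ℂ] H) (f : H), x = ampliation K X (V f)}).topologicalClosure = ⊤

end

end EnvAction

end

namespace EnvAction

/-! Minimality at every unit vector makes `{U(f, g) χ}` total in `K` for each `χ ≠ 0`. Since `U*(f₁,
g₁)` is the adjoint of `U(g₁, f₁)`, matrix elements of generators are inner products of such
vectors. If `B` is self-adjoint in the commutant and `B * C = 0`, then `⟪U(g₁, f₁) B φ, U(f₂, g₂) C
χ⟫ = 0` always, and totality forces `B = 0` or `C = 0` (`eq_zero_or_eq_zero_of_mem_centralizer`). By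
functional calculus a self-adjoint element of the commutant then has at most one spectral point, so
it is scalar. The commutant is therefore trivial and the bicommutant is everything. -/

theorem inner_envPartialTrace_adjoint_comp {H K : Type*} [NormedAddCommGroup H]
    [InnerProductSpace ℂ H] [NormedAddCommGroup K] [InnerProductSpace ℂ K] [CompleteSpace K]
    (U : HilbertTensor H K →L[ℂ] HilbertTensor H K) (f₁ g₁ f₂ g₂ : H)
    (φ χ : K) :
    ⟪φ, (envPartialTrace (ContinuousLinearMap.adjoint U) f₁ g₁ ∘L envPartialTrace U f₂ g₂) χ⟫_ℂ =
      ⟪envPartialTrace U g₁ f₁ φ, envPartialTrace U f₂ g₂ χ⟫_ℂ := by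
  rw [← star_envPartialTrace, ContinuousLinearMap.comp_apply,
    ContinuousLinearMap.star_eq_adjoint, ContinuousLinearMap.adjoint_inner_right]

section

variable {H K : Type*} [NormedAddCommGroup H] [InnerProductSpace ℂ H] [CompleteSpace H]
  [NormedAddCommGroup K] [InnerProductSpace ℂ K]

theorem inner_pureTensor_ampliation (X : H →L[ℂ] H) (h : H) (κ : K) (v : HilbertTensor H K) :
    ⟪pureTensor h κ, ampliation K X v⟫_ℂ =
      ⟪pureTensor (ContinuousLinearMap.adjoint X h) κ, v⟫_ℂ := by
  induction v using UniformSpace.Completion.induction_on with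
  | hp => exact isClosed_eq (by fun_prop) (by fun_prop)
  | ih t =>
    induction t using TensorProduct.induction_on with
    | zero => rw [UniformSpace.Completion.coe_zero, map_zero, inner_zero_right, inner_zero_right]
    | tmul f ψ =>
      change ⟪pureTensor h κ, ampliation K X (pureTensor f ψ)⟫_ℂ =
        ⟪pureTensor (ContinuousLinearMap.adjoint X h) κ, pureTensor f ψ⟫_ℂ
      rw [ampliation_pureTensor, inner_pureTensor, inner_pureTensor,
        ContinuousLinearMap.adjoint_inner_left]
    | add x y hx hy =>
      rw [UniformSpace.Completion.coe_add, map_add, inner_add_right, inner_add_right, hx, hy]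

variable [CompleteSpace K]

/-- If `U_ψ` is minimal, the vectors `U(f, g) ψ` are total in `K`. -/
theorem eq_zero_of_forall_inner_envPartialTrace [Nontrivial H]
    {U : HilbertTensor H K →L[ℂ] HilbertTensor H K} {ψ : K}
    {L : (H →L[ℂ] H) → (H →L[ℂ] H)} (hmin : IsMinimalStinespring L (dilation U ψ))
    {κ : K} (hκ : ∀ f g : H, ⟪κ, envPartialTrace U f g ψ⟫_ℂ = 0) : κ = 0 := by
  obtain ⟨h, hh⟩ := exists_ne (0 : H)
  -- Moving `X` across gives `⟪h ⊗ κ, (X ⊗ I) U (f ⊗ ψ)⟫ = ⟪κ, U(X* h, f) ψ⟫`, which vanishes by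
  -- `hκ`.
  have hmem : pureTensor h κ ∈ (Submodule.span ℂ {x : HilbertTensor H K |
      ∃ (X : H →L[ℂ] H) (f : H), x = ampliation K X (dilation U ψ f)})ᗮ := by
    rw [Submodule.mem_orthogonal']
    intro u hu
    induction hu using Submodule.span_induction with
    | mem x hx =>
      obtain ⟨X, f, rfl⟩ := hx
      rw [inner_pureTensor_ampliation]
      exact (inner_envPartialTrace U _ f κ ψ).symm.trans (hκ _ _)
    | zero => exact inner_zero_right _
    | add x y _ _ hx hy => rw [inner_add_right, hx, hy, add_zero]
    | smul a x _ hx => rw [inner_smul_right, hx, mul_zero]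
  rw [Submodule.topologicalClosure_eq_top_iff.mp hmin.2, Submodule.mem_bot] at hmem
  have hinner := inner_pureTensor h h κ κ
  rw [hmem, inner_zero_left] at hinner
  simpa [hh] using hinner.symm

/-- If every unit vector gives a minimal dilation, the vectors `U(f, g) χ` are total in `K` for
every nonzero `χ`. -/
theorem eq_zero_of_forall_inner_envPartialTrace_of_ne_zero [Nontrivial H]
    {U : HilbertTensor H K →L[ℂ] HilbertTensor H K}
    (hmin : ∀ ψ : K, ‖ψ‖ = 1 → IsMinimalStinespring (reducedMap U ψ) (dilation U ψ))
    {χ κ : K} (hχ : χ ≠ 0) (hκ : ∀ f g : H, ⟪κ, envPartialTrace U f g χ⟫_ℂ = 0) : κ = 0 := by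
  refine eq_zero_of_forall_inner_envPartialTrace
    (hmin (((‖χ‖ : ℂ)⁻¹) • χ) (norm_smul_inv_norm hχ)) fun f g => ?_
  rw [map_smul, inner_smul_right, hκ, mul_zero]

/-- A self-adjoint element of the commutant of the generators is not a left zero divisor. -/
theorem eq_zero_or_eq_zero_of_mem_centralizer [Nontrivial H]
    {U : HilbertTensor H K →L[ℂ] HilbertTensor H K}
    (hmin : ∀ ψ : K, ‖ψ‖ = 1 → IsMinimalStinespring (reducedMap U ψ) (dilation U ψ))
    {B C : K →L[ℂ] K} (hB : B ∈ Set.centralizer (rightActionGenerators U))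
    (hBsa : IsSelfAdjoint B) (hBC : B * C = 0) : B = 0 ∨ C = 0 := by
  by_contra! h
  obtain ⟨φ, hφ⟩ : ∃ φ, B φ ≠ 0 := by
    by_contra! h0
    exact h.1 (ContinuousLinearMap.ext h0)
  obtain ⟨χ, hχ⟩ : ∃ χ, C χ ≠ 0 := by
    by_contra! h0
    exact h.2 (ContinuousLinearMap.ext h0)
  have horth : ∀ f₁ g₁ f₂ g₂ : H,
      ⟪envPartialTrace U g₁ f₁ (B φ), envPartialTrace U f₂ g₂ (C χ)⟫_ℂ = 0 := by
    intro f₁ g₁ f₂ g₂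
    have hcomm := hB _ ⟨f₁, g₁, f₂, g₂, rfl⟩
    have hBCχ : B (C χ) = 0 := by simpa using DFunLike.congr_fun hBC χ
    have hval := DFunLike.congr_fun hcomm (C χ)
    rw [mul_apply_eq_comp, mul_apply_eq_comp, hBCχ, map_zero] at hval
    rw [← inner_envPartialTrace_adjoint_comp]
    -- Self-adjointness moves `B` to the right-hand side, where it passes through the generator and
    -- kills `C χ`.
    conv_lhs => rw [← hBsa.adjoint_eq]
    rw [ContinuousLinearMap.adjoint_inner_left, ← hval, inner_zero_right]
  -- Totality is used twice: at `C χ` here, then at `B φ`, whose images all vanish and yet are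
  -- total.
  have hzero : ∀ f g : H, envPartialTrace U f g (B φ) = 0 := fun f g =>
    eq_zero_of_forall_inner_envPartialTrace_of_ne_zero hmin hχ fun f₂ g₂ => horth g f f₂ g₂
  exact hφ (eq_zero_of_forall_inner_envPartialTrace_of_ne_zero hmin hφ fun f g => by
    rw [hzero, inner_zero_right])

end

end EnvAction

/-- A self-adjoint element is scalar if its continuous functional calculus has no zero
divisors. -/
theorem IsSelfAdjoint.exists_eq_algebraMap_of_cfc_mul_eq_zero {A : Type*} [CStarAlgebra A]
    {a : A} (ha : IsSelfAdjoint a)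
    (h : ∀ f g : ℝ → ℝ, cfc f a * cfc g a = 0 → cfc f a = 0 ∨ cfc g a = 0) :
    ∃ r : ℝ, a = algebraMap ℝ A r := by
  have hsub : (spectrum ℝ a).Subsingleton := by
    have key : ∀ x ∈ spectrum ℝ a, ∀ y ∈ spectrum ℝ a, ¬ x < y := by
      intro x hx y hy hxy
      -- Two ramps on opposite sides of the midpoint: their product is zero, but the first is
      -- positive at `x` and the second at `y`.
      have hmul : cfc (fun t : ℝ => max ((x + y) / 2 - t) 0) a *
          cfc (fun t : ℝ => max (t - (x + y) / 2) 0) a = 0 := by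
        rw [← cfc_mul _ _ a (by fun_prop) (by fun_prop)]
        rw [← cfc_zero ℝ a]
        congr 1
        ext t
        rcases le_total t ((x + y) / 2) with ht | ht
        · simp [max_eq_right (sub_nonpos.mpr ht)]
        · simp [max_eq_right (sub_nonpos.mpr ht)]
      rcases h _ _ hmul with h0 | h0
      · rw [← cfc_zero ℝ a] at h0
        have := (cfc_eq_cfc_iff_eqOn (R := ℝ) (a := a) ha (by fun_prop) (by fun_prop)).mp h0 hx
        have hle := max_eq_right_iff.mp this
        linarith
      · rw [← cfc_zero ℝ a] at h0
        have := (cfc_eq_cfc_iff_eqOn (R := ℝ) (a := a) ha (by fun_prop) (by fun_prop)).mp h0 hy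
        have hle := max_eq_right_iff.mp this
        linarith
    intro x hx y hy
    exact le_antisymm (not_lt.mp (key y hy x hx)) (not_lt.mp (key x hx y hy))
  obtain ⟨r, hr⟩ : ∃ r : ℝ, ∀ x ∈ spectrum ℝ a, x = r := by
    rcases (spectrum ℝ a).eq_empty_or_nonempty with he | ⟨r, hr⟩
    -- The spectrum is empty only in the zero algebra, where any scalar serves.
    · exact ⟨0, by simp [he]⟩
    · exact ⟨r, fun x hx => hsub hx hr⟩
  refine ⟨r, ?_⟩
  rw [← cfc_const r a]
  conv_lhs => rw [← cfc_id ℝ a]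
  exact cfc_congr fun x hx => hr x hx

namespace EnvAction

section

variable {H K : Type*} [NormedAddCommGroup H] [InnerProductSpace ℂ H] [CompleteSpace H]
  [NormedAddCommGroup K] [InnerProductSpace ℂ K] [CompleteSpace K]

/-- Whatever commutes with a self-adjoint `A` commutes with `cfc f A`, so the functional calculus
stays inside the commutant and inherits its lack of zero divisors. -/
theorem exists_eq_algebraMap_of_mem_centralizer [Nontrivial H]
    {U : HilbertTensor H K →L[ℂ] HilbertTensor H K}
    (hmin : ∀ ψ : K, ‖ψ‖ = 1 → IsMinimalStinespring (reducedMap U ψ) (dilation U ψ))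
    {A : K →L[ℂ] K} (hA : A ∈ Set.centralizer (rightActionGenerators U))
    (hAsa : IsSelfAdjoint A) : ∃ r : ℝ, A = algebraMap ℝ (K →L[ℂ] K) r := by
  refine hAsa.exists_eq_algebraMap_of_cfc_mul_eq_zero fun f g hfg => ?_
  refine eq_zero_or_eq_zero_of_mem_centralizer hmin (fun T hT => ?_) (cfc_predicate f A) hfg
  exact ((hAsa.commute_cfc (show Commute A T from (hA T hT).symm)) f).symm

/-- The generators are closed under `star`, hence so is the commutant; it contains the real and
imaginary parts of `A`, which are scalar. -/
theorem commute_of_mem_centralizer [Nontrivial H]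
    {U : HilbertTensor H K →L[ℂ] HilbertTensor H K}
    (hmin : ∀ ψ : K, ‖ψ‖ = 1 → IsMinimalStinespring (reducedMap U ψ) (dilation U ψ))
    {A : K →L[ℂ] K} (hA : A ∈ Set.centralizer (rightActionGenerators U)) (T : K →L[ℂ] K) :
    Commute A T := by
  have hA' : A ∈ Subalgebra.centralizer ℂ (rightActionGenerators U) := hA
  have hs' : star A ∈ Subalgebra.centralizer ℂ (rightActionGenerators U) :=
    star_mem_centralizer_of_star_eq (star_rightActionGenerators U) hA
  have hcomm : ∀ B ∈ Subalgebra.centralizer ℂ (rightActionGenerators U),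
      IsSelfAdjoint B → Commute B T := by
    intro B hB hBsa
    obtain ⟨r, rfl⟩ := exists_eq_algebraMap_of_mem_centralizer hmin hB hBsa
    exact Algebra.commutes r T
  have hre : (realPart A : K →L[ℂ] K) ∈ Subalgebra.centralizer ℂ (rightActionGenerators U) := by
    rw [realPart_apply_coe, ← Complex.coe_smul]
    exact Subalgebra.smul_mem _ (add_mem hA' hs') _
  have him : (imaginaryPart A : K →L[ℂ] K) ∈
      Subalgebra.centralizer ℂ (rightActionGenerators U) := by
    rw [imaginaryPart_apply_coe, ← Complex.coe_smul]
    exact Subalgebra.smul_mem _ (Subalgebra.smul_mem _ (sub_mem hA' hs') _) _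
  rw [← realPart_add_I_smul_imaginaryPart A]
  exact (hcomm _ hre (realPart A).2).add_left ((hcomm _ him (imaginaryPart A).2).smul_left _)

end

end EnvAction

theorem corollary3p9 {H K : Type*}
    [NormedAddCommGroup H] [InnerProductSpace ℂ H] [CompleteSpace H] [Nontrivial H]
    [NormedAddCommGroup K] [InnerProductSpace ℂ K] [CompleteSpace K]
    (U : EnvAction.HilbertTensor H K →L[ℂ] EnvAction.HilbertTensor H K)
    (hU : U ∈ unitary (EnvAction.HilbertTensor H K →L[ℂ] EnvAction.HilbertTensor H K))
    (hmin : ∀ ψ : K, ‖ψ‖ = 1 →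
      EnvAction.IsMinimalStinespring (EnvAction.reducedMap U ψ) (EnvAction.dilation U ψ)) :
    (EnvAction.rightActionAlgebra U : Set (K →L[ℂ] K)) = Set.univ := by
  rw [EnvAction.coe_rightActionAlgebra, Set.eq_univ_iff_forall]
  exact fun T A hA => EnvAction.commute_of_mem_centralizer hmin hA T
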